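/- Permutations of $\{0,1,\dots,n-1\}$ are written in vector notation $\pi=(\pi_0,\dots,\pi_{n-1})$, products are compositions of maps, and $[x \bmod n]$ denotes the representative of $x$ modulo $n$ in $\{0,\dots,n-1\}$. For $0\le i\le n-1$ and $1\le s\le n-i$ let $$\kappa_{i,s}=(0,1,\dots,i-1,\;i+s,i+s+1,\dots,n-1,\;i,i+1,\dots,i+s-1);$$ in particular $\kappa_{i,n-i}$ is the identity. Let $V_n$ be the set of integer vectors $[a_0,\dots,a_{n-1}]$ with $1\le a_j\le j+1$ for all $j$. The map $$[a_0,a_1,\dots,a_{n-1}]\mapsto \kappa_{n-2,a_1}\circ\kappa_{n-3,a_2}\circ\cdots\circ\kappa_{0,a_{n-1}}$$ is a bijection from $V_n$ to $S_n$; let $R:S_n\to V_n$ be its inverse, and for $\alpha=[a_0,\dots,a_{n-1}]\in V_n$ let $\mathrm{parity}(\alpha)=a_0+a_1+\cdots+a_{n-1}\in\mathbb Z$. Let $\rho\in S_n$, and put $\pi^{(i)}=\kappa_{n-i-1,1}\circ\rho$ for $0\le i\le n-1$ (so $\pi^{(0)}=\rho$). For a symbol $s\in\{0,\dots,n-2\}$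 let $d_s=[\rho^{-1}(s-1)-\rho^{-1}(s)\bmod n]$ if $s\ge 1$, and $d_0=n-\rho^{-1}(0)$. For $j=1,\dots,n-1$, with $s=n-1-j$, define $$b_j=\begin{cases}0 & \text{if } d_s\le[\rho^{-1}(n-1)-\rho^{-1}(s)\bmod n],\\ 1&\text{otherwise.}\end{cases}$$ In other words, in the $n$-periodic extension of $\rho$, $b_j=1$ exactly when one passes the largest symbol $n-1$ while moving to the right from symbol $n-1-j$ to the next symbol $n-2-j$ (for $j=n-1$: from symbol $0$ in positions $0,\dots,n-1$ to the end of that period). **Theorem.** For every $i=1,2,\dots,n-1$, $$\mathrm{parity}(R(\pi^{(i)}))=\mathrm{parity}(R(\rho))+i(1-b_i)-\sum_{j=1}^{i}b_j .$$ -/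

import Mathlib

namespace PermCode

/-- The suffix block transposition `κ_{i,s}` of length `n`, for `i < n` and `1 ≤ s ≤ n - i`, whose
one-line notation is `(0, …, i-1, i+s, …, n-1, i, …, i+s-1)`: positions `x < i` are fixed, and the
last `n - i` positions are cyclically shifted by `s`. In particular `κ_{i,n-i}` is the identity. -/
def kappa (n i s : ℕ) : Equiv.Perm (Fin n) where
  toFun x := if h : (x : ℕ) < i then x else
    ⟨i + ((x : ℕ) - i + s) % (n - i), by
      have := Nat.mod_lt ((x : ℕ) - i + s) (show 0 < n - i by omega)
      omega⟩
  invFun x := if h : (x : ℕ) < i then x else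
    ⟨i + ((x : ℕ) - i + (n - i - s % (n - i))) % (n - i), by
      have := Nat.mod_lt ((x : ℕ) - i + (n - i - s % (n - i))) (show 0 < n - i by omega)
      omega⟩
  left_inv x := by
    by_cases h : (x : ℕ) < i
    · simp [h]
    · have hx := x.2
      have hs := Nat.mod_lt s (show 0 < n - i by omega)
      ext
      simp only [h, dite_false, show ∀ t, ¬ (i + t < i) by omega, Nat.add_sub_cancel_left]
      rw [Nat.mod_add_mod]
      have h2 : (x : ℕ) - i + s + (n - i - s % (n - i))
          = ((x : ℕ) - i) + (n - i) * (s / (n - i) + 1) := by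
        have := Nat.mod_add_div s (n - i)
        rw [mul_add, mul_one]; omega
      rw [h2, Nat.add_mul_mod_self_left, Nat.mod_eq_of_lt (by omega)]
      omega
  right_inv x := by
    by_cases h : (x : ℕ) < i
    · simp [h]
    · have hx := x.2
      have hs := Nat.mod_lt s (show 0 < n - i by omega)
      ext
      simp only [h, dite_false, show ∀ t, ¬ (i + t < i) by omega, Nat.add_sub_cancel_left]
      rw [Nat.mod_add_mod]
      have h2 : (x : ℕ) - i + (n - i - s % (n - i)) + s
          = ((x : ℕ) - i) + (n - i) * (s / (n - i) + 1) := by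
        have := Nat.mod_add_div s (n - i)
        rw [mul_add, mul_one]; omega
      rw [h2, Nat.add_mul_mod_self_left, Nat.mod_eq_of_lt (by omega)]
      omega

theorem kappa_apply_of_lt {n i s : ℕ} {x : Fin n} (h : (x : ℕ) < i) : kappa n i s x = x := by
  simp [kappa, h]

theorem kappa_apply_of_le {n i s : ℕ} {x : Fin n} (h : i ≤ (x : ℕ)) :
    (kappa n i s x : ℕ) = i + ((x : ℕ) - i + s) % (n - i) := by
  simp [kappa, Nat.not_lt.mpr h]

/-- The set `V_n` of vectors `[a_0, …, a_{n-1}]` with `1 ≤ a_j ≤ j + 1`. -/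
abbrev V (n : ℕ) : Type := {a : Fin n → ℕ // ∀ j : Fin n, 1 ≤ a j ∧ a j ≤ (j : ℕ) + 1}

/-- The map `[a_0, …, a_{n-1}] ↦ κ_{n-2,a_1} κ_{n-3,a_2} ⋯ κ_{0,a_{n-1}}`. The list of factors
below begins with the additional factor `κ_{n-1,a_0} = κ_{n-1,1}`, which is the identity. -/
def toPerm {n : ℕ} (a : V n) : Equiv.Perm (Fin n) :=
  (List.ofFn fun j : Fin n => kappa n (n - 1 - (j : ℕ)) (a.1 j)).prod

/-- Partial products of block transpositions, for the proof that `toPerm` is bijective. -/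
def partialProd (n : ℕ) (a : ℕ → ℕ) (k : ℕ) : Equiv.Perm (Fin n) :=
  ((List.range k).map fun j => kappa n (n - 1 - j) (a j)).prod

theorem partialProd_succ (n : ℕ) (a : ℕ → ℕ) (k : ℕ) :
    partialProd n a (k + 1) = partialProd n a k * kappa n (n - 1 - k) (a k) := by
  simp [partialProd, List.range_succ]

theorem partialProd_fix (n : ℕ) (a : ℕ → ℕ) (k : ℕ) (hk : k ≤ n) (x : Fin n)
    (hx : (x : ℕ) < n - k) : partialProd n a k x = x := by
  induction k with
  | zero => simp [partialProd]
  | succ k ih =>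
    rw [partialProd_succ, Equiv.Perm.mul_apply, kappa_apply_of_lt (by omega)]
    exact ih (by omega) (by omega)

theorem partialProd_inj (n : ℕ) (a b : ℕ → ℕ)
    (ha : ∀ j < n, 1 ≤ a j ∧ a j ≤ j + 1) (hb : ∀ j < n, 1 ≤ b j ∧ b j ≤ j + 1)
    (k : ℕ) (hk : k ≤ n) (h : partialProd n a k = partialProd n b k) :
    ∀ j < k, a j = b j := by
  induction k with
  | zero => intro j hj; omega
  | succ k ih =>
    have key : ∀ c : ℕ → ℕ, ∀ y : Fin n, partialProd n c (k + 1) y = ⟨n - 1 - k, by omega⟩ →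
        kappa n (n - 1 - k) (c k) y = ⟨n - 1 - k, by omega⟩ := by
      intro c y hy
      rw [partialProd_succ, Equiv.Perm.mul_apply] at hy
      apply (partialProd n c k).injective
      rw [hy, partialProd_fix n c k (by omega)]
      simp only
      omega
    obtain ⟨y, hy⟩ := (partialProd n a (k + 1)).surjective ⟨n - 1 - k, by omega⟩
    have h1 := key a y hy
    have h2 := key b y (h ▸ hy)
    have hyk : n - 1 - k ≤ (y : ℕ) := by
      by_contra hlt
      rw [kappa_apply_of_lt (by omega)] at h1
      have := congrArg Fin.val h1
      simp only at this
      omega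
    have h1' := congrArg Fin.val h1
    have h2' := congrArg Fin.val h2
    rw [kappa_apply_of_le hyk] at h1' h2'
    simp only at h1' h2'
    have e : n - (n - 1 - k) = k + 1 := by omega
    rw [e] at h1' h2'
    have hak := ha k (by omega)
    have hbk := hb k (by omega)
    have hab : a k = b k := by
      have hm : (y : ℕ) - (n - 1 - k) + a k ≡ (y : ℕ) - (n - 1 - k) + b k [MOD (k + 1)] := by
        unfold Nat.ModEq; omega
      have hm' : a k ≡ b k [MOD (k + 1)] := Nat.ModEq.add_left_cancel' _ hm
      have hm2 : (a k - 1) + 1 ≡ (b k - 1) + 1 [MOD (k + 1)] := by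
        rwa [Nat.sub_add_cancel hak.1, Nat.sub_add_cancel hbk.1]
      have hm3 := Nat.ModEq.eq_of_lt_of_lt (Nat.ModEq.add_right_cancel' 1 hm2)
        (by omega) (by omega)
      omega
    intro j hj
    rcases Nat.lt_succ_iff_lt_or_eq.mp hj with hj | rfl
    · refine ih (by omega) ?_ j hj
      rw [partialProd_succ, partialProd_succ, hab] at h
      exact mul_right_cancel h
    · exact hab

theorem toPerm_eq_partialProd {n : ℕ} (a : V n) :
    toPerm a = partialProd n (fun j => if h : j < n then a.1 ⟨j, h⟩ else 1) n := by
  unfold toPerm partialProd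
  congr 1
  apply List.ext_getElem
  · simp
  · intro i h1 h2
    have : i < n := by simpa using h1
    simp [this]

theorem toPerm_bijective (n : ℕ) : Function.Bijective (toPerm (n := n)) := by
  have hinj : Function.Injective (toPerm (n := n)) := by
    intro a b hab
    rw [toPerm_eq_partialProd, toPerm_eq_partialProd] at hab
    have := partialProd_inj n _ _ (fun j hj => by simpa [hj] using a.2 ⟨j, hj⟩)
      (fun j hj => by simpa [hj] using b.2 ⟨j, hj⟩) n le_rfl hab
    ext j
    simpa using this j j.2
  refine hinj.bijective_of_nat_card_le ?_
  have e : V n ≃ ((j : Fin n) → Finset.Icc 1 ((j : ℕ) + 1)) :=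
    (Equiv.subtypeEquivRight fun a => by simp only [Finset.mem_Icc]).trans
      (Equiv.subtypePiEquivPi (p := fun (j : Fin n) (m : ℕ) => m ∈ Finset.Icc 1 ((j : ℕ) + 1)))
  rw [Nat.card_congr e, Nat.card_pi, Nat.card_perm]
  simp only [Nat.card_eq_fintype_card, Fintype.card_coe, Nat.card_Icc, Nat.add_sub_cancel,
    Fintype.card_fin]
  rw [Fin.prod_univ_eq_prod_range (fun j => j + 1) n, Finset.prod_range_add_one_eq_factorial]

/-- `R π` is the unique vector of `V_n` that `toPerm` sends to `π`. -/
noncomputable def R {n : ℕ} (π : Equiv.Perm (Fin n)) : V n :=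
  (Equiv.ofBijective toPerm (toPerm_bijective n)).symm π

/-- The parity of a vector is the sum of its components, as an integer (not reduced modulo 2). -/
def parity {n : ℕ} (a : V n) : ℤ := ∑ j : Fin n, (a.1 j : ℤ)

/-- `π^{(j)} = κ_{n-j-1,1} ∘ ρ`. -/
def piSeq {n : ℕ} (ρ : Equiv.Perm (Fin n)) (j : ℕ) : Equiv.Perm (Fin n) :=
  kappa n (n - j - 1) 1 * ρ

/-- `[q - p mod n]`, the number of steps to the right, cyclically, from position `p` to
position `q`. -/
def cyclicDist {n : ℕ} (p q : Fin n) : ℤ := (((q : ℕ) : ℤ) - ((p : ℕ) : ℤ)) % (n : ℤ)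

/-- The number of steps to the right from the position `ρ⁻¹ i` of symbol `i` to the position of
symbol `i - 1`. The position of symbol `-1` is `n` by convention (the beginning of the next
period), so that the distance from symbol `0` is `n - ρ⁻¹ 0`. -/
def stepDist {n : ℕ} (ρ : Equiv.Perm (Fin n)) (i : Fin n) : ℤ :=
  if (i : ℕ) = 0 then (n : ℤ) - ((ρ⁻¹ i : Fin n) : ℕ)
  else cyclicDist (ρ⁻¹ i) (ρ⁻¹ ⟨(i : ℕ) - 1, by omega⟩)

/-- The numbers `b_j` for `j = 1, …, n-1`. With `i = n - 1 - j` (written `j.rev`), `b_j = 0` if one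
does not pass through the largest symbol `n-1` on the way to the right from symbol `i` to symbol
`i-1`, that is, if the walk from `i` to `i-1` is no longer than the walk from `i` to the next
occurrence of `n-1`. Otherwise `b_j = 1`. The two walks can have equal length only for `i = 0`, when
`n-1` is the first symbol of the next period, which is not passed. (The value at `j = 0` is not
used.) -/
def b {n : ℕ} (ρ : Equiv.Perm (Fin n)) (j : Fin n) : ℤ :=
  if stepDist ρ j.rev ≤ cyclicDist (ρ⁻¹ j.rev) (ρ⁻¹ ⟨n - 1, by have := j.2; omega⟩) then 0 else 1

end PermCode

namespace PermCode

/-! The code has a cyclic description: the component of `R σ` with index `n - 1 - s` is the number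
of symbols `t ≥ s` met in `σ` on the cyclic walk from `s` (included) to `s - 1` (excluded). Hence
`parity_R`, which turns the parity into a sum of such counts.

Put `m = n - 1 - i`. Passing from `ρ` to `piSeq ρ i` only relabels: symbols below `m` stay, `m, …,
n-2` go up by one, and `n-1` becomes `m`. The counts below `m` do not change. For `m < s < n-1`, the
old walk from `s` becomes the new walk from `s + 1` and loses only the old symbol `n-1`, that is,
one `b`. The old walk from `m` is replaced by two walks meeting at the old `n-1`; together they
cover the old arc, plus one full turn (`n - m` symbols) if that arc avoids `n-1` (`arcInd_split`).
The old count 1 of symbol `n-1` disappears. `sum_arcCount_relabel` adds these up. -/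

/-- The indicator of the cyclic arc that starts at `a` (included) and ends at `z` (excluded). -/
def arcInd (a z x : ℕ) : ℤ :=
  if (a ≤ x ∧ x < z) ∨ (z < a ∧ (a ≤ x ∨ x < z)) then 1 else 0

/-- A detour through `w` costs nothing if `w` lies on the arc, and one extra full turn otherwise. -/
theorem arcInd_split {a z w : ℕ} (hzw : z ≠ w) (x : ℕ) :
    arcInd w z x + arcInd a w x = arcInd a z x + (1 - arcInd a z w) := by
  unfold arcInd
  split_ifs <;> omega

theorem arcInd_right (a z : ℕ) : arcInd a z z = 0 := by
  unfold arcInd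
  split_ifs <;> omega

theorem arcInd_left {a z : ℕ} (h : a ≠ z) : arcInd a z a = 1 := by
  unfold arcInd
  split_ifs <;> omega

/-- If the symbol `t` has position `P (t + 1)`, and `P 0` is the end of the period, this is the
number of symbols `t` with `s ≤ t < n` that occur on the way to the right from `s` to `s - 1`. -/
def arcCount (n : ℕ) (P : ℕ → ℕ) (s : ℕ) : ℤ :=
  ∑ t ∈ Finset.Ico s n, arcInd (P (s + 1)) (P s) (P (t + 1))

/-! ### Effect of the relabelling on the arc counts -/

section Relabel

variable {n m : ℕ} {P Q : ℕ → ℕ}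

theorem sum_relabel (hm : m < n) (h1 : Q (m + 1) = P n)
    (h2 : ∀ t, m < t → t < n → Q (t + 1) = P t) (f : ℕ → ℤ) :
    ∑ t ∈ Finset.Ico m n, f (Q (t + 1)) = ∑ t ∈ Finset.Ico m n, f (P (t + 1)) := by
  obtain ⟨k, rfl⟩ : ∃ k, n = k + 1 := ⟨n - 1, by omega⟩
  rw [Finset.sum_eq_sum_Ico_succ_bot hm, h1,
    Finset.sum_Ico_succ_top (show m ≤ k by omega) (fun t => f (P (t + 1))), add_comm]
  congr 1
  rw [← Finset.sum_Ico_add' (fun t => f (Q (t + 1))) m k 1]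
  refine Finset.sum_congr rfl fun t ht => ?_
  rw [Finset.mem_Ico] at ht
  rw [h2 (t + 1) (by omega) (by omega)]

theorem arcCount_relabel_of_lt (hm : m < n) (h0 : ∀ t ≤ m, Q t = P t) (h1 : Q (m + 1) = P n)
    (h2 : ∀ t, m < t → t < n → Q (t + 1) = P t) {s : ℕ} (hs : s < m) :
    arcCount n Q s = arcCount n P s := by
  unfold arcCount
  rw [h0 s hs.le, h0 (s + 1) hs, ← Finset.sum_Ico_consecutive _ hs.le hm.le,
    ← Finset.sum_Ico_consecutive _ hs.le hm.le,
    sum_relabel hm h1 h2 (fun x => arcInd (P (s + 1)) (P s) x)]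
  congr 1
  refine Finset.sum_congr rfl fun t ht => ?_
  rw [Finset.mem_Ico] at ht
  rw [h0 (t + 1) (by omega)]

theorem arcCount_relabel_succ (h2 : ∀ t, m < t → t < n → Q (t + 1) = P t)
    {s : ℕ} (hs : m < s) (hsn : s + 1 < n) :
    arcCount n Q (s + 1) = arcCount n P s - arcInd (P (s + 1)) (P s) (P n) := by
  obtain ⟨k, rfl⟩ : ∃ k, n = k + 1 := ⟨n - 1, by omega⟩
  unfold arcCount
  rw [Finset.sum_Ico_succ_top (show s ≤ k by omega) (fun t => arcInd _ _ (P (t + 1))),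
    add_sub_cancel_right, h2 s hs (by omega),
    h2 (s + 1) (by omega) hsn]
  rw [← Finset.sum_Ico_add' (fun t => arcInd (P (s + 1)) (P s) (Q (t + 1))) s k 1]
  refine Finset.sum_congr rfl fun t ht => ?_
  rw [Finset.mem_Ico] at ht
  rw [h2 (t + 1) (by omega) (by omega)]

theorem arcCount_relabel_pair (hm : m + 1 < n) (hP : ∀ x y, x ≤ n → y ≤ n → P x = P y → x = y)
    (h0 : ∀ t ≤ m, Q t = P t) (h1 : Q (m + 1) = P n)
    (h2 : ∀ t, m < t → t < n → Q (t + 1) = P t) :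
    arcCount n Q m + arcCount n Q (m + 1) =
      arcCount n P m + ((n : ℤ) - m) * (1 - arcInd (P (m + 1)) (P m) (P n)) := by
  have e : arcCount n Q (m + 1) =
      ∑ t ∈ Finset.Ico m n, arcInd (P (m + 1)) (P n) (P (t + 1)) := by
    rw [← sum_relabel (by omega) h1 h2 (fun x => arcInd (P (m + 1)) (P n) x),
      Finset.sum_eq_sum_Ico_succ_bot (by omega), h1, arcInd_right, zero_add, arcCount, h1,
      h2 (m + 1) (by omega) hm]
  rw [e, arcCount, h0 m le_rfl, h1,
    sum_relabel (by omega) h1 h2 (fun x => arcInd (P n) (P m) x), ← Finset.sum_add_distrib]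
  have key : ∀ x, arcInd (P n) (P m) x + arcInd (P (m + 1)) (P n) x =
      arcInd (P (m + 1)) (P m) x + (1 - arcInd (P (m + 1)) (P m) (P n)) := by
    refine arcInd_split fun h => ?_
    have := hP _ _ (by omega) (by omega) h
    omega
  simp_rw [key]
  rw [Finset.sum_add_distrib, Finset.sum_const, Nat.card_Ico, nsmul_eq_mul,
    Nat.cast_sub (by omega), arcCount]

theorem sum_arcCount_relabel (hm : m + 1 < n)
    (hP : ∀ x y, x ≤ n → y ≤ n → P x = P y → x = y)
    (h0 : ∀ t ≤ m, Q t = P t) (h1 : Q (m + 1) = P n)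
    (h2 : ∀ t, m < t → t < n → Q (t + 1) = P t) :
    ∑ s ∈ Finset.range n, arcCount n Q s = ∑ s ∈ Finset.range n, arcCount n P s
      + ((n : ℤ) - 1 - m) * (1 - arcInd (P (m + 1)) (P m) (P n))
      - ∑ s ∈ Finset.Ico m (n - 1), arcInd (P (s + 1)) (P s) (P n) := by
  have hpair := arcCount_relabel_pair hm hP h0 h1 h2
  obtain ⟨k, rfl⟩ : ∃ k, n = k + 1 := ⟨n - 1, by omega⟩
  have htop : arcCount (k + 1) P k = 1 := by
    rw [arcCount, Nat.Ico_succ_singleton, Finset.sum_singleton, arcInd_left]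
    intro h
    have := hP _ _ (by omega) (by omega) h
    omega
  have hlow : ∑ s ∈ Finset.range m, arcCount (k + 1) Q s
      = ∑ s ∈ Finset.range m, arcCount (k + 1) P s :=
    Finset.sum_congr rfl fun s hs =>
      arcCount_relabel_of_lt (by omega) h0 h1 h2 (Finset.mem_range.mp hs)
  have hhigh : ∑ s ∈ Finset.Ico (m + 1 + 1) (k + 1), arcCount (k + 1) Q s
      = ∑ s ∈ Finset.Ico (m + 1) k, arcCount (k + 1) P s
        - ∑ s ∈ Finset.Ico (m + 1) k, arcInd (P (s + 1)) (P s) (P (k + 1)) := by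
    rw [← Finset.sum_Ico_add' (fun s => arcCount (k + 1) Q s) (m + 1) k 1,
      ← Finset.sum_sub_distrib]
    refine Finset.sum_congr rfl fun s hs => ?_
    rw [Finset.mem_Ico] at hs
    exact arcCount_relabel_succ h2 (by omega) (by omega)
  rw [← Finset.sum_range_add_sum_Ico (arcCount (k + 1) Q) (show m ≤ k + 1 by omega),
    Finset.sum_eq_sum_Ico_succ_bot (show m < k + 1 by omega),
    Finset.sum_eq_sum_Ico_succ_bot (show m + 1 < k + 1 by omega), hlow, hhigh,
    Finset.sum_range_succ, htop,
    ← Finset.sum_range_add_sum_Ico (arcCount (k + 1) P) (show m ≤ k by omega),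
    Finset.sum_eq_sum_Ico_succ_bot (show m < k by omega), Nat.add_sub_cancel,
    Finset.sum_eq_sum_Ico_succ_bot (show m < k by omega)]
  -- With `β` the indicator for `m`, this uses `(n - m)(1 - β) - 1 = (n - 1 - m)(1 - β) - β`, the
  -- `-1` coming from `htop`.
  push_cast at hpair ⊢
  linear_combination hpair

end Relabel

/-- The positions of the symbols of `σ`, with index shifted by one, preceded by the end `n` of the
period. -/
def extPos {n : ℕ} (σ : Equiv.Perm (Fin n)) : ℕ → ℕ
  | 0 => n
  | t + 1 => if h : t < n then (σ⁻¹ ⟨t, h⟩ : Fin n) else 0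

section ExtPos

variable {n : ℕ}

theorem perm_apply_inv_apply (σ : Equiv.Perm (Fin n)) (x : Fin n) : σ (σ⁻¹ x) = x :=
  σ.apply_symm_apply x

theorem extPos_zero (σ : Equiv.Perm (Fin n)) : extPos σ 0 = n := rfl

theorem extPos_succ (σ : Equiv.Perm (Fin n)) {t : ℕ} (h : t < n) :
    extPos σ (t + 1) = (σ⁻¹ ⟨t, h⟩ : Fin n) := by
  simp [extPos, h]

theorem extPos_succ_eq_of_apply {σ : Equiv.Perm (Fin n)} {x y : Fin n} (h : σ x = y) :
    extPos σ ((y : ℕ) + 1) = x := by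
  rw [extPos_succ σ y.2, ← h]
  simp

theorem extPos_injective (σ : Equiv.Perm (Fin n)) (x y : ℕ) (hx : x ≤ n) (hy : y ≤ n)
    (h : extPos σ x = extPos σ y) : x = y := by
  rcases x with _ | x <;> rcases y with _ | y
  · rfl
  · rw [extPos_zero, extPos_succ σ (by omega)] at h; omega
  · rw [extPos_zero, extPos_succ σ (by omega)] at h; omega
  · rw [extPos_succ σ (by omega), extPos_succ σ (by omega)] at h
    simpa using σ⁻¹.injective (Fin.ext h)

/-! ### The components of the code as arc counts -/

theorem kappa_val {m a : ℕ} (h1 : 1 ≤ a) (h2 : a ≤ n - m) {x : Fin n} (hx : m ≤ (x : ℕ)) :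
    ((x : ℕ) + a < n ∧ (kappa n m a x : ℕ) = x + a) ∨
      (n ≤ (x : ℕ) + a ∧ (kappa n m a x : ℕ) + (n - m) = x + a) := by
  have hxn := x.2
  rw [kappa_apply_of_le hx]
  rcases lt_or_ge ((x : ℕ) + a) n with h | h
  · rw [Nat.mod_eq_of_lt (by omega)]; omega
  · rw [Nat.mod_eq_sub_mod (by omega), Nat.mod_eq_of_lt (by omega)]; omega

theorem arcInd_kappa {m a : ℕ} (h1 : 1 ≤ a) (h2 : a ≤ n - m) {x y z : Fin n}
    (hx : m ≤ (x : ℕ)) (hy : m ≤ (y : ℕ)) (hz : m ≤ (z : ℕ)) :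
    arcInd (kappa n m a x) (kappa n m a y) (kappa n m a z) = arcInd x y z := by
  have ex := kappa_val h1 h2 hx
  have ey := kappa_val h1 h2 hy
  have ez := kappa_val h1 h2 hz
  have := x.2
  have := y.2
  have := z.2
  unfold arcInd
  congr 1
  apply propext
  omega

theorem le_inv_apply_of_fix {σ : Equiv.Perm (Fin n)} {m : ℕ}
    (hσ : ∀ x : Fin n, (x : ℕ) < m → σ x = x) {t : Fin n} (ht : m ≤ (t : ℕ)) :
    m ≤ ((σ⁻¹ t : Fin n) : ℕ) := by
  by_contra h
  have := hσ (σ⁻¹ t) (by omega)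
  rw [perm_apply_inv_apply] at this
  rw [← this] at h
  exact h ht

/-- The symbols involved are all at least `m`, since `s - 1 ≥ m`. They occupy positions from `m` on,
which the factor rotates, preserving cyclic order. -/
theorem arcCount_mul_kappa_of_lt {σ : Equiv.Perm (Fin n)} {m a : ℕ} (h1 : 1 ≤ a)
    (h2 : a ≤ n - m) (hσ : ∀ x : Fin n, (x : ℕ) < m → σ x = x) {s : ℕ} (hs : m < s) (hsn : s < n) :
    arcCount n (extPos (σ * kappa n m a)) s = arcCount n (extPos σ) s := by
  obtain ⟨r, rfl⟩ : ∃ r, s = r + 1 := ⟨s - 1, by omega⟩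
  refine Finset.sum_congr rfl fun t ht => ?_
  rw [Finset.mem_Ico] at ht
  have key : ∀ u : Fin n, m ≤ (u : ℕ) → m ≤ (((σ * kappa n m a)⁻¹ u : Fin n) : ℕ) ∧
      kappa n m a ((σ * kappa n m a)⁻¹ u) = σ⁻¹ u := by
    intro u hu
    refine ⟨le_inv_apply_of_fix (fun x hx => ?_) hu, by simp [mul_inv_rev]⟩
    rw [Equiv.Perm.mul_apply, kappa_apply_of_lt hx, hσ x hx]
  have kr := key ⟨r, by omega⟩ (by simp only; omega)
  have ks := key ⟨r + 1, by omega⟩ (by simp only; omega)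
  have kt := key ⟨t, by omega⟩ (by simp only; omega)
  rw [extPos_succ _ (show r + 1 < n by omega), extPos_succ _ (show r < n by omega),
    extPos_succ _ (show t < n by omega), extPos_succ _ (show r + 1 < n by omega),
    extPos_succ _ (show r < n by omega), extPos_succ _ (show t < n by omega),
    ← kr.2, ← ks.2, ← kt.2, arcInd_kappa h1 h2 ks.1 kr.1 kt.1]

theorem arcCount_mul_kappa_self {σ : Equiv.Perm (Fin n)} {m a : ℕ} (hm : m < n) (h1 : 1 ≤ a)
    (h2 : a ≤ n - m) (hσ : ∀ x : Fin n, (x : ℕ) ≤ m → σ x = x) :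
    arcCount n (extPos (σ * kappa n m a)) m = a := by
  set τ := σ * kappa n m a with hτ
  have hfix : ∀ x : Fin n, (x : ℕ) < m → τ x = x := fun x hx => by
    rw [hτ, Equiv.Perm.mul_apply, kappa_apply_of_lt hx, hσ x hx.le]
  have hpos : extPos τ (m + 1) = n - a := by
    have hk : τ ⟨n - a, by omega⟩ = ⟨m, hm⟩ := by
      have : kappa n m a ⟨n - a, by omega⟩ = ⟨m, hm⟩ := by
        have := kappa_val h1 h2 (x := ⟨n - a, by omega⟩) (by simp only; omega)
        ext
        simp only at this ⊢
        omega
      rw [hτ, Equiv.Perm.mul_apply, this, hσ _ le_rfl]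
    exact extPos_succ_eq_of_apply hk
  -- In both cases the arc from position `n - a` meets the positions from `m` on exactly in the last
  -- `a` places.
  have hend : extPos τ m = n ∨ extPos τ m < m := by
    rcases m with _ | r
    · exact Or.inl rfl
    · right
      have := extPos_succ_eq_of_apply (hfix ⟨r, by omega⟩ (by simp))
      simp only at this
      omega
  have hterm : ∀ t ∈ Finset.Ico m n, arcInd (extPos τ (m + 1)) (extPos τ m) (extPos τ (t + 1))
      = if n - a ≤ extPos τ (t + 1) then 1 else 0 := by
    intro t ht
    rw [Finset.mem_Ico] at ht
    have hge := le_inv_apply_of_fix hfix (t := ⟨t, ht.2⟩) ht.1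
    have hlt := (τ⁻¹ ⟨t, ht.2⟩).2
    rw [hpos, extPos_succ τ ht.2]
    unfold arcInd
    congr 1
    apply propext
    omega
  rw [arcCount, Finset.sum_congr rfl hterm, Finset.sum_boole]
  have hcard : (Finset.Ico (n - a) n).card = a := by rw [Nat.card_Ico]; omega
  congr 1
  refine Eq.trans ?_ hcard
  refine Finset.card_bij (fun t _ => extPos τ (t + 1)) ?_ ?_ ?_
  · intro t ht
    rw [Finset.mem_filter, Finset.mem_Ico] at ht
    rw [Finset.mem_Ico]
    refine ⟨ht.2, ?_⟩
    rw [extPos_succ τ ht.1.2]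
    exact Fin.is_lt _
  · intro t ht u hu h
    rw [Finset.mem_filter, Finset.mem_Ico] at ht hu
    have := extPos_injective τ _ _ (by omega) (by omega) h
    omega
  · intro x hx
    rw [Finset.mem_Ico] at hx
    have hx' := extPos_succ_eq_of_apply (σ := τ) (x := ⟨x, hx.2⟩) rfl
    refine ⟨(τ ⟨x, hx.2⟩ : Fin n), ?_, hx'⟩
    rw [Finset.mem_filter, Finset.mem_Ico, hx']
    refine ⟨⟨?_, Fin.is_lt _⟩, hx.1⟩
    -- A symbol below `m` would be fixed by `τ`, so it would sit at its own position, whereas `x ≥ n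
    -- - a ≥ m`.
    by_contra h
    have := hfix (τ ⟨x, hx.2⟩) (by omega)
    have := congrArg Fin.val (τ.injective this)
    simp only at this
    omega

theorem arcCount_partialProd (c : ℕ → ℕ) (hc : ∀ j < n, 1 ≤ c j ∧ c j ≤ j + 1) (k : ℕ)
    (hk : k ≤ n) : ∀ j < k, arcCount n (extPos (partialProd n c k)) (n - 1 - j) = c j := by
  induction k with
  | zero => intro j hj; omega
  | succ k ih =>
    intro j hj
    have hck := hc k (by omega)
    have hfix := partialProd_fix n c k (by omega)
    rw [partialProd_succ]
    rcases Nat.lt_succ_iff_lt_or_eq.mp hj with hj | rfl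
    · rw [arcCount_mul_kappa_of_lt hck.1 (by omega) (fun x hx => hfix x (by omega)) (by omega)
        (by omega), ih (by omega) j hj]
    · exact arcCount_mul_kappa_self (by omega) hck.1 (by omega) (fun x hx => hfix x (by omega))

theorem parity_R (σ : Equiv.Perm (Fin n)) :
    parity (R σ) = ∑ s ∈ Finset.range n, arcCount n (extPos σ) s := by
  have hR : toPerm (R σ) = σ := (Equiv.ofBijective toPerm (toPerm_bijective n)).apply_symm_apply σ
  rw [toPerm_eq_partialProd] at hR
  rw [← Finset.sum_range_reflect, ← Fin.sum_univ_eq_sum_range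
    (fun j => arcCount n (extPos σ) (n - 1 - j)), parity]
  refine Finset.sum_congr rfl fun j _ => ?_
  have := arcCount_partialProd (n := n) (fun j => if h : j < n then (R σ).1 ⟨j, h⟩ else 1)
    (fun j hj => by simpa [hj] using (R σ).2 ⟨j, hj⟩) n le_rfl j j.2
  rw [hR] at this
  simpa using this.symm

/-! ### The numbers `b` as arc indicators -/

theorem cyclicDist_cases (p q : Fin n) :
    ((p : ℕ) ≤ q ∧ cyclicDist p q = q - p) ∨ ((q : ℕ) < p ∧ cyclicDist p q = q - p + n) := by
  have hp := p.2
  have hq := q.2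
  unfold cyclicDist
  rcases le_or_gt (p : ℕ) q with h | h
  · left
    exact ⟨h, Int.emod_eq_of_lt (by omega) (by omega)⟩
  · right
    refine ⟨h, ?_⟩
    rw [← Int.add_emod_right, Int.emod_eq_of_lt (by omega) (by omega)]

theorem b_eq_arcInd (ρ : Equiv.Perm (Fin n)) {j : Fin n} (hj : 1 ≤ (j : ℕ)) :
    b ρ j = arcInd (extPos ρ (n - 1 - j + 1)) (extPos ρ (n - 1 - j)) (extPos ρ n) := by
  have hjn := j.2
  obtain ⟨s, hs⟩ : ∃ s, s = n - 1 - (j : ℕ) := ⟨_, rfl⟩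
  have hrev : j.rev = ⟨s, by omega⟩ := by
    ext
    simp only [Fin.val_rev]
    omega
  have hlast : extPos ρ n = (ρ⁻¹ ⟨n - 1, by omega⟩ : Fin n) := by
    rw [← extPos_succ]
    congr 1
    omega
  rw [← hs, b, hrev, hlast, extPos_succ ρ (show s < n by omega)]
  have hN := cyclicDist_cases (ρ⁻¹ ⟨s, by omega⟩) (ρ⁻¹ ⟨n - 1, by omega⟩)
  have := (ρ⁻¹ ⟨s, by omega⟩).2
  have := (ρ⁻¹ ⟨n - 1, by omega⟩).2
  rcases s with _ | r
  · rw [extPos_zero]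
    simp only [stepDist, if_true, arcInd]
    split_ifs <;> omega
  · have hd := cyclicDist_cases (ρ⁻¹ ⟨r + 1, by omega⟩) (ρ⁻¹ ⟨r, by omega⟩)
    rw [extPos_succ ρ (show r < n by omega)]
    simp only [stepDist, Nat.add_sub_cancel, arcInd, Nat.succ_ne_zero, if_false]
    split_ifs <;> omega

/-! ### Positions of the symbols in `piSeq ρ i` -/

theorem extPos_piSeq_of_le (ρ : Equiv.Perm (Fin n)) {i : ℕ} {t : ℕ}
    (ht : t ≤ n - i - 1) : extPos (piSeq ρ i) t = extPos ρ t := by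
  rcases t with _ | t
  · rfl
  · rw [extPos_succ ρ (show t < n by omega)]
    refine extPos_succ_eq_of_apply (y := ⟨t, by omega⟩) ?_
    rw [piSeq, Equiv.Perm.mul_apply, perm_apply_inv_apply, kappa_apply_of_lt]
    simp only
    omega

theorem extPos_piSeq_bot (ρ : Equiv.Perm (Fin n)) {i : ℕ} (hi : i < n) :
    extPos (piSeq ρ i) (n - i - 1 + 1) = extPos ρ n := by
  have hlast : extPos ρ n = (ρ⁻¹ ⟨n - 1, by omega⟩ : Fin n) := by
    rw [← extPos_succ]
    congr 1
    omega
  rw [hlast]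
  refine extPos_succ_eq_of_apply (y := ⟨n - i - 1, by omega⟩) ?_
  rw [piSeq, Equiv.Perm.mul_apply, perm_apply_inv_apply]
  have := kappa_val (n := n) (m := n - i - 1) (a := 1) le_rfl (by omega)
    (x := ⟨n - 1, by omega⟩) (by simp only; omega)
  ext
  simp only at this ⊢
  omega

theorem extPos_piSeq_succ (ρ : Equiv.Perm (Fin n)) {i : ℕ} {t : ℕ}
    (h1 : n - i - 1 < t) (h2 : t < n) : extPos (piSeq ρ i) (t + 1) = extPos ρ t := by
  obtain ⟨r, rfl⟩ : ∃ r, t = r + 1 := ⟨t - 1, by omega⟩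
  rw [extPos_succ ρ (show r < n by omega)]
  refine extPos_succ_eq_of_apply (y := ⟨r + 1, h2⟩) ?_
  rw [piSeq, Equiv.Perm.mul_apply, perm_apply_inv_apply]
  have := kappa_val (n := n) (m := n - i - 1) (a := 1) le_rfl (by omega)
    (x := ⟨r, by omega⟩) (by simp only; omega)
  ext
  simp only at this ⊢
  omega

theorem sum_b (ρ : Equiv.Perm (Fin n)) (i : Fin n) :
    ∑ j ∈ Finset.univ.filter (fun j : Fin n => 1 ≤ (j : ℕ) ∧ j ≤ i), b ρ j =
      ∑ s ∈ Finset.Ico (n - i - 1) (n - 1),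
        arcInd (extPos ρ (s + 1)) (extPos ρ s) (extPos ρ n) := by
  have hi := i.2
  refine Finset.sum_bij (fun j _ => n - 1 - (j : ℕ)) ?_ ?_ ?_ ?_
  · intro j hj
    simp only [Finset.mem_filter, Finset.mem_univ, true_and, Fin.le_def] at hj
    rw [Finset.mem_Ico]
    omega
  · intro j _ k _ h
    ext
    have := j.2
    have := k.2
    omega
  · intro s hs
    rw [Finset.mem_Ico] at hs
    refine ⟨⟨n - 1 - s, by omega⟩, ?_, ?_⟩
    · simp only [Finset.mem_filter, Finset.mem_univ, true_and, Fin.le_def]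
      omega
    · simp only
      omega
  · intro j hj
    simp only [Finset.mem_filter, Finset.mem_univ, true_and] at hj
    exact b_eq_arcInd ρ hj.1

end ExtPos

end PermCode

theorem mainTheorem2 (n : ℕ) (ρ : Equiv.Perm (Fin n)) (i : Fin n) (hi : 1 ≤ (i : ℕ)) :
    PermCode.parity (PermCode.R (PermCode.piSeq ρ (i : ℕ))) =
      PermCode.parity (PermCode.R ρ) + ((i : ℕ) : ℤ) * (1 - PermCode.b ρ i)
        - ∑ j ∈ Finset.univ.filter (fun j : Fin n => 1 ≤ (j : ℕ) ∧ j ≤ i), PermCode.b ρ j := by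
  have hin := i.2
  have h := PermCode.sum_arcCount_relabel (m := n - i - 1) (by omega)
    (PermCode.extPos_injective ρ) (fun _ ht => PermCode.extPos_piSeq_of_le ρ ht)
    (PermCode.extPos_piSeq_bot ρ hin) (fun _ h1 h2 => PermCode.extPos_piSeq_succ ρ h1 h2)
  have hm : (n : ℤ) - 1 - ((n - i - 1 : ℕ) : ℤ) = ((i : ℕ) : ℤ) := by omega
  rw [PermCode.parity_R, PermCode.parity_R, PermCode.sum_b, PermCode.b_eq_arcInd ρ hi, h, hm,
    show n - 1 - (i : ℕ) = n - i - 1 by omega]
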